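/- \textbf{Setting.} Let $L=[0,\infty]\cup\{\bot\}$, ordered by extending the usual order on $[0,\infty]$ with $\bot$ as least element. Let $\mathcal F$ be the set of monotonic functions $f:L\times[0,\infty]\to L$ with $f(\bot,t)=\bot$ for all $t$, and let $\mathcal V$ be the set of monotonic functions $v:L\times[0,\infty]\to\{\mathbf{ff}<\mathbf{tt}\}$ with $v(\bot,t)=\mathbf{ff}$ for all $t$. On both sets let $\vee$ be the pointwise maximum, $\le$ the pointwise order, and $\bot$ the constant function with value $\bot$, respectively $\mathbf{ff}$. For $f\in\mathcal F$ and $g\in\mathcal F$ or $g\in\mathcal V$, define the composition $$(f\triangleright g)(x,t)=\bigvee_{t_1+t_2=t} g(f(x,t_1),t_2)\qquad(t_1,t_2\in[0,\infty]),$$ and let $\mathbf 1\in\mathcal F$ be given by $\mathbf 1(x,t)=x$. For $f\in\mathcal F$ put $f^0=\mathbf 1$, $f^{n+1}=f^n\triangleright f$, and let $f^*=\bigvee_{n\ge0}f^n$ (pointwise supremum). For real numbers $r\ge0$, $p\le0$ and $b\ge-p$, the \emph{atomic real-time energy function} with rate $r$, bound $b$ and price $p$ is the $f\in\mathcal F$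 with $f(\bot,t)=\bot$ and $f(\infty,t)=\infty$ for all $t\in[0,\infty]$, $f(x,\infty)=\infty$ for $x\neq\bot$, and, for $x,t\in[0,\infty)$, $f(x,t)=x+rt+p$ if $x+rt\ge b$ and $f(x,t)=\bot$ otherwise. The set $\mathcal E\subseteq\mathcal F$ of \emph{real-time energy functions} is the least subset of $\mathcal F$ that contains all atomic real-time energy functions, $\bot$ and $\mathbf 1$, and is closed under $\triangleright$ and $\vee$. For $f_0,f_1,\ldots\in\mathcal F$, let $\prod_{n\ge0}f_n\in\mathcal V$ be the function whose value at $(x,t)$ is $\mathbf{tt}$ iff there are $t_0,t_1,\ldots\in[0,\infty]$ with $\sum_{n\ge0}t_n=t$ such that the sequence $x_0=x$, $x_{n+1}=f_n(x_n,t_n)$ satisfies $x_{n+1}\ne\bot$ for all $n\ge0$. Let $\mathcal U\subseteq\mathcal V$ be the least subset that contains $\bot$ and all infinite products $\prod_{n\ge0}f_n$ with $f_0,f_1,\ldots\in\mathcal E$ and is closed under $\vee$ and under $v\mapsto g\triangleright v$ for all $g\in\mathcal F$. \textbf{Proposition.} The set $\mathcal E$ is closed under $f\mapsto f^*$. With the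 operations $\vee,\triangleright,{}^*,\bot,\mathbf 1$ on $\mathcal E$, with $\vee,\bot$ on $\mathcal U$, with the action $(f,v)\mapsto f\triangleright v$ of $\mathcal E$ on $\mathcal U$, and with the infinite product $\mathcal E^\omega\to\mathcal U$, the pair $(\mathcal E,\mathcal U)$ is a $^*$-continuous Kleene $\omega$-algebra. The same holds if, in the definition of $\mathcal U$, closure under $v\mapsto g\triangleright v$ is required only for $g\in\mathcal E$. Explicitly, write $xy$ and $xv$ for product and action. Then: \begin{itemize} \item $(\mathcal E,\vee,\triangleright,{}^*,\bot,\mathbf 1)$ is a $^*$-continuous Kleene algebra. That is, it is an idempotent semiring in which $yx^*$ is the least solution of $z=zx\vee y$ and $x^*y$ is the least solution of $z=xz\vee y$, and in which $x^*=\bigvee_{n}x^n$, $yx^*=\bigvee_{n}yx^n$ and $x^*y=\bigvee_{n}x^ny$. \item $\mathcal U$ is an idempotent left $\mathcal E$-semimodule: $(s\vee s')v=sv\vee s'v$, $s(v\vee v')=sv\vee sv'$, $\bot v=\bot$, $(ss')v=s(s'v)$, $s\bot=\bot$ and $\mathbf 1v=v$. Moreover $xy^*v=\bigvee_{n\ge0}xy^nv$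 for all $x,y\in\mathcal E$ and $v\in\mathcal U$. \item (Ax1) $\prod_{n\ge0}x_n=x_0\prod_{n\ge0}x_{n+1}$ for all $x_0,x_1,\ldots\in\mathcal E$. \item (Ax2) If $x_0,x_1,\ldots\in\mathcal E$, $0=n_0\le n_1\le\cdots$ is unbounded, and $y_k=x_{n_k}\cdots x_{n_{k+1}-1}$ (an empty product being $\mathbf 1$), then $\prod_{n\ge0}x_n=\prod_{k\ge0}y_k$. \item (Ax3) $\prod_{n\ge0}(x_n(y\vee z))=\bigvee_{x_0',x_1',\ldots\in\{y,z\}}\prod_{n\ge0}x_nx_n'$ for all $x_0,x_1,\ldots,y,z\in\mathcal E$. \item (Ax4) $\prod_{n\ge0}x^*y_n=\bigvee_{k_0,k_1,\ldots\ge0}\prod_{n\ge0}x^{k_n}y_n$ for all $x,y_0,y_1,\ldots\in\mathcal E$. \end{itemize} All suprema here are taken in $\mathcal E$ or $\mathcal U$, and their existence is part of the claim. -/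

import Mathlib

open scoped ENNReal NNReal Computability

/-! ### Star-continuous Kleene algebras and Kleene omega-algebras -/

/-- A star-continuous Kleene algebra: a Kleene algebra (Mathlib's `KleeneAlgebra`, with `⊔ = +` and
`⊥ = 0`) in which `x∗` is the supremum of the powers of `x`, and product preserves these suprema. -/
class StarContinuousKleeneAlgebra (S : Type*) extends KleeneAlgebra S where
  isLUB_kstar : ∀ x : S, IsLUB (Set.range fun n : ℕ => x ^ n) x∗
  isLUB_mul_kstar : ∀ x y : S, IsLUB (Set.range fun n : ℕ => y * x ^ n) (y * x∗)
  isLUB_kstar_mul : ∀ x y : S, IsLUB (Set.range fun n : ℕ => x ^ n * y) (x∗ * y)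

/-- An idempotent left semimodule `V` over an idempotent semiring `S`. The idempotent commutative
monoid `(V, ∨, ⊥)` is given as a join-semilattice with least element. -/
class IdemSemimodule (S V : Type*) [IdemSemiring S] [SemilatticeSup V] [OrderBot V]
    extends SMul S V where
  sup_smul : ∀ (s s' : S) (v : V), (s ⊔ s') • v = s • v ⊔ s' • v
  smul_sup : ∀ (s : S) (v v' : V), s • (v ⊔ v') = s • v ⊔ s • v'
  bot_smul : ∀ v : V, (⊥ : S) • v = ⊥
  mul_smul : ∀ (s s' : S) (v : V), (s * s') • v = s • (s' • v)
  smul_bot : ∀ s : S, s • (⊥ : V) = ⊥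
  one_smul : ∀ v : V, (1 : S) • v = v

/-- A generalized star-continuous Kleene algebra `(S, V)`: an idempotent semiring-semimodule pair
over a star-continuous Kleene algebra `S` such that `x y∗ v = ⋁ₙ x yⁿ v`. -/
class GeneralizedStarContinuousKleeneAlgebra (S V : Type*) [StarContinuousKleeneAlgebra S]
    [SemilatticeSup V] [OrderBot V] extends IdemSemimodule S V where
  isLUB_mul_kstar_smul : ∀ (x y : S) (v : V),
    IsLUB (Set.range fun n : ℕ => (x * y ^ n) • v) ((x * y∗) • v)

/-- A star-continuous Kleene omega-algebra `(S, V)`: a generalized star-continuous Kleene algebra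
with an infinite product `S^ω → V` subject to the four axioms below. -/
class StarContinuousKleeneOmegaAlgebra (S V : Type*) [StarContinuousKleeneAlgebra S]
    [SemilatticeSup V] [OrderBot V] extends GeneralizedStarContinuousKleeneAlgebra S V where
  /-- the infinite product -/
  infProd : (ℕ → S) → V
  ax1 : ∀ x : ℕ → S, infProd x = x 0 • infProd (fun n => x (n + 1))
  ax2 : ∀ (x : ℕ → S) (n : ℕ → ℕ), n 0 = 0 → Monotone n → (∀ m, ∃ k, m ≤ n k) →
    infProd x =
      infProd (fun k => (List.ofFn fun i : Fin (n (k + 1) - n k) => x (n k + (i : ℕ))).prod)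
  ax3 : ∀ (x : ℕ → S) (y z : S),
    IsLUB {w : V | ∃ x' : ℕ → S, (∀ n, x' n = y ∨ x' n = z) ∧ w = infProd fun n => x n * x' n}
      (infProd fun n => x n * (y ⊔ z))
  ax4 : ∀ (x : S) (y : ℕ → S),
    IsLUB {w : V | ∃ k : ℕ → ℕ, w = infProd fun n => x ^ k n * y n}
      (infProd fun n => x∗ * y n)

/-! ### Monotonic functions of energy and time -/

namespace RealTimeEnergy

/-- The energy levels `[0, ∞]` with a new bottom element; `⊥` is absorbing for addition. -/
abbrev Level := WithBot ℝ≥0∞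

/-- Monotonic functions `Level × [0, ∞] → Y` that map `(⊥, t)` to `⊥`. -/
abbrev TimedFun (Y : Type*) [CompleteLattice Y] : Type _ :=
  {f : Level × ℝ≥0∞ → Y // Monotone f ∧ ∀ t, f (⊥, t) = ⊥}

section TimedFun

variable {Y : Type*} [CompleteLattice Y]

/-- The pointwise supremum `f ∨ g`. -/
instance : SemilatticeSup (TimedFun Y) :=
  Subtype.semilatticeSup fun {f g} hf hg => ⟨hf.1.sup hg.1, fun t => by simp [hf.2 t, hg.2 t]⟩

/-- The constant function `⊥`. -/
instance : OrderBot (TimedFun Y) :=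
  Subtype.orderBot ⟨fun _ _ _ => le_rfl, fun _ => rfl⟩

/-- The composition `(f ▹ g)(x, t) = ⋁_{t₁ + t₂ = t} g (f (x, t₁), t₂)`, in diagrammatic order. -/
noncomputable def comp (f : TimedFun Level) (g : TimedFun Y) : TimedFun Y :=
  ⟨fun p => ⨆ (t₁ : ℝ≥0∞) (t₂ : ℝ≥0∞) (_ : t₁ + t₂ = p.2), g.1 (f.1 (p.1, t₁), t₂), by
    constructor
    · rintro ⟨x, t⟩ ⟨x', t'⟩ ⟨hx, ht⟩
      refine iSup_le fun t₁ => iSup_le fun t₂ => iSup_le fun h => ?_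
      obtain ⟨d, rfl⟩ := exists_add_of_le ht
      refine le_trans ?_ (le_iSup_of_le t₁ (le_iSup_of_le (t₂ + d) (le_iSup_of_le ?_ le_rfl)))
      · exact g.2.1 ⟨f.2.1 ⟨hx, le_rfl⟩, le_self_add⟩
      · simp only at h ⊢
        rw [← h, add_assoc]
    · intro t
      simp [f.2.2, g.2.2]⟩

end TimedFun

/-- The set `F` of monotonic functions `f : L × [0, ∞] → L` with `f (⊥, t) = ⊥`. -/
abbrev EnergyFun : Type := TimedFun Level

/-- The set `V` of monotonic functions `v : L × [0, ∞] → {false < true}` with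
`v (⊥, t) = false`; the Boolean lattice is `Prop`, ordered by implication. -/
abbrev BoolFun : Type := TimedFun Prop

/-- The unit `𝟏 (x, t) = x` of composition. -/
def one : EnergyFun := ⟨fun p => p.1, fun _ _ h => h.1, fun _ => rfl⟩

/-- The iterated composition `f ▹ f ▹ ⋯ ▹ f`. -/
noncomputable def iter (f : EnergyFun) : ℕ → EnergyFun
  | 0 => one
  | n + 1 => comp (iter f n) f

/-- The pointwise supremum `⋁ₙ fⁿ` of all iterated compositions. -/
noncomputable def star (f : EnergyFun) : EnergyFun :=
  ⟨fun p => ⨆ n : ℕ, (iter f n).1 p,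
    fun _ _ h => iSup_mono fun n => (iter f n).2.1 h,
    fun t => by simp [(iter f _).2.2]⟩

/-- `f` is the atomic real-time energy function with rate `r`, bound `b` and price `p`. -/
structure IsAtomicWith (r b p : ℝ) (f : EnergyFun) : Prop where
  map_bot : ∀ t, f.1 (⊥, t) = ⊥
  map_top : ∀ t, f.1 (((∞ : ℝ≥0∞) : Level), t) = ((∞ : ℝ≥0∞) : Level)
  map_time_top : ∀ x : Level, x ≠ ⊥ → f.1 (x, ∞) = ((∞ : ℝ≥0∞) : Level)
  map_of_le : ∀ x t : ℝ≥0, b ≤ x + r * t →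
    f.1 (((x : ℝ≥0∞) : Level), (t : ℝ≥0∞)) = ((ENNReal.ofReal (x + r * t + p) : ℝ≥0∞) : Level)
  map_of_lt : ∀ x t : ℝ≥0, x + r * t < b → f.1 (((x : ℝ≥0∞) : Level), (t : ℝ≥0∞)) = ⊥

/-- Atomic real-time energy functions. Under these hypotheses on `r`, `b`, `p` the value
`x + r t + p` is nonnegative whenever it is used. -/
def IsAtomic (f : EnergyFun) : Prop :=
  ∃ r b p : ℝ, 0 ≤ r ∧ p ≤ 0 ∧ -p ≤ b ∧ IsAtomicWith r b p f

/-- Real-time energy functions: the least subset of `EnergyFun` that contains the atomic functions,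
the neutral elements `⊥` and `𝟏`, and is closed under composition and binary suprema. -/
inductive IsRTEF : EnergyFun → Prop
  | atomic (f : EnergyFun) : IsAtomic f → IsRTEF f
  | bot : IsRTEF ⊥
  | one : IsRTEF one
  | comp (f g : EnergyFun) : IsRTEF f → IsRTEF g → IsRTEF (comp f g)
  | sup (f g : EnergyFun) : IsRTEF f → IsRTEF g → IsRTEF (f ⊔ g)

/-- The set `E` of real-time energy functions. -/
def RTEF : Type := {f : EnergyFun // IsRTEF f}

/-- `prefixVal f τ x n` is `(f (n-1)) (τ (n-1)) ∘ ⋯ ∘ (f 0) (τ 0)` applied to `x`. -/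
def prefixVal (f : ℕ → EnergyFun) (τ : ℕ → ℝ≥0∞) (x : Level) : ℕ → Level
  | 0 => x
  | n + 1 => (f n).1 (prefixVal f τ x n, τ n)

/-- The infinite product `F^ω → V`: it is true at `(x, t)` iff there are delays `τ 0, τ 1, …` in
`[0, ∞]` with sum `t` such that no finite prefix of the composition yields `⊥`. -/
noncomputable def infProd (f : ℕ → EnergyFun) : BoolFun :=
  ⟨fun p => ∃ τ : ℕ → ℝ≥0∞, ∑' n, τ n = p.2 ∧ ∀ n, prefixVal f τ p.1 (n + 1) ≠ ⊥, by
    constructor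
    · rintro ⟨x, t⟩ ⟨x', t'⟩ ⟨hx, ht⟩ ⟨τ, hτ, hne⟩
      obtain ⟨d, rfl⟩ := exists_add_of_le ht
      simp only at hτ hx hne
      refine ⟨fun n => τ n + if n = 0 then d else 0, ?_, fun n => ?_⟩
      · rw [ENNReal.tsum_add, hτ, tsum_ite_eq]
      · refine ne_bot_of_le_ne_bot (hne n) ?_
        generalize n + 1 = m
        induction m with
        | zero => exact hx
        | succ m ih => exact (f m).2.1 ⟨ih, le_self_add⟩
    · intro t
      simp only [eq_iff_iff]
      refine iff_of_false ?_ id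
      rintro ⟨τ, -, hne⟩
      exact hne 0 ((f 0).2.2 _)⟩

/-- Membership in the subsemimodule of `V` generated by the infinite products of real-time energy
functions, where scalars range over the set `G` of functions. -/
inductive InSpan (G : Set EnergyFun) : BoolFun → Prop
  | infProd (f : ℕ → EnergyFun) : (∀ n, IsRTEF (f n)) → InSpan G (infProd f)
  | bot : InSpan G ⊥
  | sup (u v : BoolFun) : InSpan G u → InSpan G v → InSpan G (u ⊔ v)
  | smul (g : EnergyFun) (v : BoolFun) : g ∈ G → InSpan G v → InSpan G (comp g v)

/-- The set `U` generated by the infinite products of real-time energy functions, with scalars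
in `G`, and with the pointwise order. -/
abbrev Span (G : Set EnergyFun) : Type := {v : BoolFun // InSpan G v}

instance (G : Set EnergyFun) : SemilatticeSup (Span G) :=
  Subtype.semilatticeSup fun {u v} hu hv => InSpan.sup u v hu hv

instance (G : Set EnergyFun) : OrderBot (Span G) := Subtype.orderBot InSpan.bot

end RealTimeEnergy

/-! Two facts about real-time energy functions carry the proof.

Attainment: atomic functions are upper semicontinuous, i.e. have closed hypographs (`ClosedReach`).
As `[0, ∞]` is compact, composition preserves this property, and the supremum defining a composition
is a maximum (`reach_comp_iff`, `exists_comp_apply_eq`). For merely monotone functions this can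
fail. Attainment yields associativity (`comp_assoc`) and allows the delay of a finite block to be
distributed over its factors, which is Ax2.

Stabilisation: each function is a finite join of functions `a` with a definite rate. If `b` has rate
at most that of `a`, then `a * b ≤ a`: time spent in `b` is better spent in `a`. Adding the
functions in order of increasing rate shows that the powers of `1 + f` stabilise
(`exists_one_add_pow_le`). Hence the star is a finite join of powers. It lies in the algebra, and
every map preserving binary joins preserves it; this gives all continuity laws, including that of
the action.

In Ax3 and Ax4, linearity of the energy levels makes a finite join agree at each argument with one
of its members. Choosing that member at the arguments met along a given run bounds the infinite
product (`infProd_le_of_forall_exists`). -/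

namespace RealTimeEnergy

/-! ### Semiring laws of composition that need only monotonicity -/

section TimedFun

variable {Y : Type*} [CompleteLattice Y]

theorem TimedFun.ext {f g : TimedFun Y} (h : ∀ x t, f.1 (x, t) = g.1 (x, t)) : f = g :=
  Subtype.ext (funext fun p => h p.1 p.2)

theorem comp_apply (f : EnergyFun) (g : TimedFun Y) (x : Level) (t : ℝ≥0∞) :
    (comp f g).1 (x, t) =
      ⨆ (t₁ : ℝ≥0∞) (t₂ : ℝ≥0∞) (_ : t₁ + t₂ = t), g.1 (f.1 (x, t₁), t₂) :=
  rfl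

theorem le_comp_apply (f : EnergyFun) (g : TimedFun Y) (x : Level) (t₁ t₂ : ℝ≥0∞) :
    g.1 (f.1 (x, t₁), t₂) ≤ (comp f g).1 (x, t₁ + t₂) :=
  le_iSup_of_le t₁ (le_iSup_of_le t₂ (le_iSup_of_le rfl le_rfl))

theorem comp_apply_le {f : EnergyFun} {g : TimedFun Y} {x : Level} {t : ℝ≥0∞} {y : Y}
    (h : ∀ t₁ t₂, t₁ + t₂ = t → g.1 (f.1 (x, t₁), t₂) ≤ y) : (comp f g).1 (x, t) ≤ y :=
  iSup_le fun t₁ => iSup_le fun t₂ => iSup_le fun e => h t₁ t₂ e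

theorem comp_mono {f f' : EnergyFun} {g g' : TimedFun Y} (hf : f ≤ f') (hg : g ≤ g') :
    comp f g ≤ comp f' g' := by
  rintro ⟨x, t⟩
  refine comp_apply_le ?_
  rintro t₁ t₂ rfl
  refine le_trans ?_ (le_comp_apply f' g' x t₁ t₂)
  exact (hg _).trans (g'.2.1 ⟨hf (x, t₁), le_rfl⟩)

theorem one_comp (g : TimedFun Y) : comp one g = g := by
  refine le_antisymm ?_ ?_
  · rintro ⟨x, t⟩
    refine comp_apply_le ?_
    rintro t₁ t₂ rfl
    exact g.2.1 ⟨le_rfl, le_add_self⟩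
  · rintro ⟨x, t⟩
    simpa [one] using le_comp_apply one g x 0 t

theorem comp_one (f : EnergyFun) : comp f one = f := by
  refine le_antisymm ?_ ?_
  · rintro ⟨x, t⟩
    refine comp_apply_le ?_
    rintro t₁ t₂ rfl
    exact f.2.1 ⟨le_rfl, le_self_add⟩
  · rintro ⟨x, t⟩
    simpa [one] using le_comp_apply f one x t 0

theorem bot_comp (g : TimedFun Y) : comp ⊥ g = ⊥ := by
  refine le_antisymm ?_ bot_le
  rintro ⟨x, t⟩
  exact comp_apply_le fun t₁ t₂ _ => (g.2.2 t₂).le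

theorem comp_bot (f : EnergyFun) : comp f (⊥ : TimedFun Y) = ⊥ := by
  refine le_antisymm ?_ bot_le
  rintro ⟨x, t⟩
  exact comp_apply_le fun t₁ t₂ _ => le_rfl

/-- Energy levels are linearly ordered, so `f ⊔ f'` takes at each argument the value of `f` or of
`f'`; `g` need not preserve joins. -/
theorem sup_comp (f f' : EnergyFun) (g : TimedFun Y) :
    comp (f ⊔ f') g = comp f g ⊔ comp f' g := by
  refine le_antisymm ?_ (sup_le (comp_mono le_sup_left le_rfl) (comp_mono le_sup_right le_rfl))
  rintro ⟨x, t⟩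
  refine comp_apply_le ?_
  rintro t₁ t₂ rfl
  change g.1 (f.1 (x, t₁) ⊔ f'.1 (x, t₁), t₂) ≤ _ ⊔ _
  rcases le_total (f.1 (x, t₁)) (f'.1 (x, t₁)) with h | h
  · rw [sup_eq_right.2 h]
    exact le_sup_of_le_right (le_comp_apply f' g x t₁ t₂)
  · rw [sup_eq_left.2 h]
    exact le_sup_of_le_left (le_comp_apply f g x t₁ t₂)

theorem comp_sup (f : EnergyFun) (g g' : TimedFun Y) :
    comp f (g ⊔ g') = comp f g ⊔ comp f g' := by
  refine le_antisymm ?_ (sup_le (comp_mono le_rfl le_sup_left) (comp_mono le_rfl le_sup_right))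
  rintro ⟨x, t⟩
  refine comp_apply_le ?_
  rintro t₁ t₂ rfl
  exact sup_le_sup (le_comp_apply f g x t₁ t₂) (le_comp_apply f g' x t₁ t₂)

end TimedFun

/-! ### Reachability of finite energy levels -/

/-- From energy level `x` the function `f` reaches at least level `y` within time `t`. -/
def Reach (f : EnergyFun) (x t y : ℝ≥0∞) : Prop :=
  (y : Level) ≤ f.1 ((x : Level), t)

theorem Reach.mono {f : EnergyFun} {x x' t t' y y' : ℝ≥0∞} (h : Reach f x t y) (hx : x ≤ x')
    (ht : t ≤ t') (hy : y' ≤ y) : Reach f x' t' y' :=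
  (WithBot.coe_le_coe.2 hy).trans (h.trans (f.2.1 ⟨WithBot.coe_le_coe.2 hx, ht⟩))

theorem TimedFun.apply_mono {Y : Type*} [CompleteLattice Y] (f : TimedFun Y) {x x' : Level}
    (h : x ≤ x') (t : ℝ≥0∞) : f.1 (x, t) ≤ f.1 (x', t) :=
  f.2.1 (Prod.mk_le_mk.2 ⟨h, le_rfl⟩)

theorem le_of_reach {f g : EnergyFun} (h : ∀ x t y, Reach f x t y → Reach g x t y) : f ≤ g := by
  rintro ⟨x, t⟩
  induction x using WithBot.recBotCoe with
  | bot => rw [f.2.2]; exact bot_le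
  | coe x =>
    cases hy : f.1 ((x : Level), t) using WithBot.recBotCoe with
    | bot => exact bot_le
    | coe y => exact h x t y hy.ge

theorem reach_sup {f g : EnergyFun} {x t y : ℝ≥0∞} :
    Reach (f ⊔ g) x t y ↔ Reach f x t y ∨ Reach g x t y :=
  le_sup_iff (a := (y : Level))

theorem not_reach_bot {x t y : ℝ≥0∞} : ¬ Reach ⊥ x t y := fun h =>
  WithBot.coe_ne_bot (le_bot_iff.1 h)

theorem reach_one {x t y : ℝ≥0∞} : Reach one x t y ↔ y ≤ x :=
  WithBot.coe_le_coe

/-- The energy function `f` is upper semicontinuous, stated as closedness of its hypograph. -/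
def ClosedReach (f : EnergyFun) : Prop :=
  IsClosed {p : ℝ≥0∞ × ℝ≥0∞ × ℝ≥0∞ | Reach f p.1 p.2.1 p.2.2}

/-- The set is a projection of a closed set along the compact space of triples `(t₁, t₂, z)`. -/
theorem isClosed_exists_reach_reach {f g : EnergyFun} (hf : ClosedReach f) (hg : ClosedReach g) :
    IsClosed {p : ℝ≥0∞ × ℝ≥0∞ × ℝ≥0∞ |
      ∃ t₁ t₂ z, t₁ + t₂ = p.2.1 ∧ Reach f p.1 t₁ z ∧ Reach g z t₂ p.2.2} := by
  have key : IsClosed {q : (ℝ≥0∞ × ℝ≥0∞ × ℝ≥0∞) × (ℝ≥0∞ × ℝ≥0∞ × ℝ≥0∞) |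
      q.2.1 + q.2.2.1 = q.1.2.1 ∧ Reach f q.1.1 q.2.1 q.2.2.2 ∧
        Reach g q.2.2.2 q.2.2.1 q.1.2.2} := by
    refine (isClosed_eq (by fun_prop) (by fun_prop)).inter (IsClosed.inter ?_ ?_)
    · exact hf.preimage (f := fun q : (ℝ≥0∞ × ℝ≥0∞ × ℝ≥0∞) × (ℝ≥0∞ × ℝ≥0∞ × ℝ≥0∞) =>
        (q.1.1, q.2.1, q.2.2.2)) (by fun_prop)
    · exact hg.preimage (f := fun q : (ℝ≥0∞ × ℝ≥0∞ × ℝ≥0∞) × (ℝ≥0∞ × ℝ≥0∞ × ℝ≥0∞) =>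
        (q.2.2.2, q.2.2.1, q.1.2.2)) (by fun_prop)
  convert isClosedMap_fst_of_compactSpace _ key using 1
  ext p
  constructor
  · rintro ⟨t₁, t₂, z, h⟩
    exact ⟨(p, t₁, t₂, z), h, rfl⟩
  · rintro ⟨⟨_, t₁, t₂, z⟩, h, rfl⟩
    exact ⟨t₁, t₂, z, h⟩

theorem Reach.comp {f g : EnergyFun} {x t₁ t₂ y z : ℝ≥0∞} (hf : Reach f x t₁ z)
    (hg : Reach g z t₂ y) : Reach (comp f g) x (t₁ + t₂) y :=
  (hg.trans (g.apply_mono hf t₂)).trans (le_comp_apply f g x t₁ t₂)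

theorem exists_reach_of_le {f g : EnergyFun} {x t₁ t₂ y : ℝ≥0∞}
    (h : (y : Level) ≤ g.1 (f.1 ((x : Level), t₁), t₂)) : ∃ z, Reach f x t₁ z ∧ Reach g z t₂ y := by
  cases hz : f.1 ((x : Level), t₁) using WithBot.recBotCoe with
  | bot =>
    rw [hz, g.2.2] at h
    exact absurd (le_bot_iff.1 h) WithBot.coe_ne_bot
  | coe z => exact ⟨z, hz.ge, by rwa [hz] at h⟩

theorem exists_reach_of_lt_comp {f g : EnergyFun} {x t : ℝ≥0∞} {a : Level}
    (h : a < (comp f g).1 ((x : Level), t)) :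
    ∃ t₁ t₂, t₁ + t₂ = t ∧ a < g.1 (f.1 ((x : Level), t₁), t₂) := by
  rw [comp_apply] at h
  obtain ⟨t₁, h⟩ := lt_iSup_iff.1 h
  obtain ⟨t₂, h⟩ := lt_iSup_iff.1 h
  obtain ⟨e, h⟩ := lt_iSup_iff.1 h
  exact ⟨t₁, t₂, e, h⟩

/-- The supremum defining a composition of upper semicontinuous functions is attained. -/
theorem reach_comp_iff {f g : EnergyFun} (hf : ClosedReach f) (hg : ClosedReach g)
    {x t y : ℝ≥0∞} :
    Reach (comp f g) x t y ↔ ∃ t₁ t₂ z, t₁ + t₂ = t ∧ Reach f x t₁ z ∧ Reach g z t₂ y := by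
  refine ⟨fun h => ?_, ?_⟩
  -- Level `0` has no smaller level in `[0, ∞]` to approximate it; there the strict inequality `⊥ <
  -- 0` suffices. Any other `y` is a limit of levels `y' < y`, each reached by some split, and
  -- closedness passes to the limit.
  · rcases eq_or_ne y 0 with rfl | hy
    · obtain ⟨t₁, t₂, e, h'⟩ := exists_reach_of_lt_comp ((WithBot.bot_lt_coe _).trans_le h)
      obtain ⟨z, hz⟩ := exists_reach_of_le (f := f) (g := g) (x := x) (t₁ := t₁) (t₂ := t₂)
        (y := 0) (by
          cases hb : g.1 (f.1 ((x : Level), t₁), t₂) using WithBot.recBotCoe with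
          | bot => exact absurd (hb ▸ h') (lt_irrefl _)
          | coe b => exact WithBot.coe_le_coe.2 bot_le)
      exact ⟨t₁, t₂, z, e, hz⟩
    · have hc := (isClosed_exists_reach_reach hf hg).preimage
        (f := fun y : ℝ≥0∞ => (x, t, y)) (by fun_prop)
      refine hc.closure_subset_iff.2 ?_
        ((closure_Iio' ⟨0, pos_iff_ne_zero.2 hy⟩).ge (Set.mem_Iic.2 (le_refl y)))
      intro y' hy'
      obtain ⟨t₁, t₂, e, h'⟩ := exists_reach_of_lt_comp ((WithBot.coe_lt_coe.2 hy').trans_le h)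
      obtain ⟨z, hz⟩ := exists_reach_of_le h'.le
      exact ⟨t₁, t₂, z, e, hz⟩
  · rintro ⟨t₁, t₂, z, rfl, h₁, h₂⟩
    exact h₁.comp h₂

theorem closedReach_comp {f g : EnergyFun} (hf : ClosedReach f) (hg : ClosedReach g) :
    ClosedReach (comp f g) := by
  simpa only [ClosedReach, reach_comp_iff hf hg] using isClosed_exists_reach_reach hf hg

theorem closedReach_sup {f g : EnergyFun} (hf : ClosedReach f) (hg : ClosedReach g) :
    ClosedReach (f ⊔ g) := by
  simpa only [ClosedReach, reach_sup, Set.ofPred_or] using IsClosed.union hf hg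

theorem closedReach_bot : ClosedReach ⊥ := by
  simp [ClosedReach, not_reach_bot]

theorem closedReach_one : ClosedReach one := by
  simp only [ClosedReach, reach_one]
  exact isClosed_le (by fun_prop) (by fun_prop)

theorem exists_comp_apply_eq {f g : EnergyFun} (hf : ClosedReach f) (hg : ClosedReach g)
    (x : Level) (t : ℝ≥0∞) :
    ∃ t₁ t₂, t₁ + t₂ = t ∧ (comp f g).1 (x, t) = g.1 (f.1 (x, t₁), t₂) := by
  have hle : ∀ t₁ t₂, t₁ + t₂ = t → g.1 (f.1 (x, t₁), t₂) ≤ (comp f g).1 (x, t) := by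
    rintro t₁ t₂ rfl
    exact le_comp_apply f g x t₁ t₂
  cases hy : (comp f g).1 (x, t) using WithBot.recBotCoe with
  | bot => exact ⟨0, t, zero_add t, (le_bot_iff.1 ((hle 0 t (zero_add t)).trans_eq hy)).symm⟩
  | coe y =>
    cases x using WithBot.recBotCoe with
    | bot => rw [(comp f g).2.2] at hy; exact absurd hy.symm WithBot.coe_ne_bot
    | coe x =>
      obtain ⟨t₁, t₂, z, e, h₁, h₂⟩ :=
        (reach_comp_iff hf hg).1 (show Reach (comp f g) x t y from hy.ge)
      exact ⟨t₁, t₂, e, le_antisymm (h₂.trans (g.apply_mono h₁ t₂)) (hy ▸ hle t₁ t₂ e)⟩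

/-- Only `≤` needs closedness: `h` need not commute with the supremum in `comp f g`, but that
supremum is attained. The last factor is arbitrary, so the lemma also covers the action. -/
theorem comp_assoc {Y : Type*} [CompleteLattice Y] {f g : EnergyFun} (hf : ClosedReach f)
    (hg : ClosedReach g) (h : TimedFun Y) : comp (comp f g) h = comp f (comp g h) := by
  refine le_antisymm ?_ ?_
  · rintro ⟨x, t⟩
    refine comp_apply_le ?_
    rintro t₁ t₂ rfl
    obtain ⟨s₁, s₂, rfl, e⟩ := exists_comp_apply_eq hf hg x t₁
    rw [e, add_assoc]
    exact (le_comp_apply g h _ s₂ t₂).trans (le_comp_apply f (comp g h) x s₁ (s₂ + t₂))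
  · rintro ⟨x, t⟩
    refine comp_apply_le ?_
    rintro t₁ t₂ rfl
    refine comp_apply_le ?_
    rintro s₁ s₂ rfl
    rw [← add_assoc]
    exact (h.apply_mono (le_comp_apply f g x t₁ s₁) s₂).trans
      (le_comp_apply (comp f g) h x (t₁ + s₁) s₂)

/-! ### Rates -/

/-- The energy gained within a delay; `⊥` is the rate of the unit, which gains nothing even within
infinite time, and all other rates gain infinite energy within infinite time. -/
noncomputable def gain : WithBot ℝ≥0 → ℝ≥0∞ → ℝ≥0∞
  | ⊥, _ => 0
  | (r : ℝ≥0), t => r * t + if t = ∞ then ∞ else 0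

theorem gain_add (ρ : WithBot ℝ≥0) (s t : ℝ≥0∞) : gain ρ (s + t) = gain ρ s + gain ρ t := by
  cases ρ with
  | bot => simp [gain]
  | coe r =>
    by_cases hs : s = ∞ <;> by_cases ht : t = ∞ <;> simp [gain, hs, ht, mul_add]

theorem gain_mono {ρ σ : WithBot ℝ≥0} (h : ρ ≤ σ) (t : ℝ≥0∞) : gain ρ t ≤ gain σ t := by
  cases ρ with
  | bot => simp [gain]
  | coe r =>
    cases σ with
    | bot => exact absurd (le_bot_iff.1 h) WithBot.coe_ne_bot
    | coe s =>
      have : (r : ℝ≥0∞) ≤ s := ENNReal.coe_le_coe.2 (WithBot.coe_le_coe.1 h)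
      simp only [gain]
      gcongr

/-- The function `f` gains energy at most at rate `ρ`, and exactly at this rate once it is enabled;
moreover it preserves surplus energy. -/
structure HasRate (f : EnergyFun) (ρ : WithBot ℝ≥0) : Prop where
  le_add_gain : ∀ {x t y}, Reach f x t y → y ≤ x + gain ρ t
  add_delay : ∀ {x t y}, Reach f x t y → ∀ s, Reach f x (t + s) (y + gain ρ s)
  add_energy : ∀ {x t y}, Reach f x t y → ∀ e, Reach f (x + e) t (y + e)

theorem hasRate_one : HasRate one ⊥ where
  le_add_gain h := by simpa [gain] using reach_one.1 h
  add_delay h s := by simpa [gain, reach_one] using h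
  add_energy h e := reach_one.2 (by gcongr; exact reach_one.1 h)

/-- Additional delay is spent in the faster factor. If this is the first one, the second passes the
surplus on by `add_energy`. -/
theorem HasRate.comp {f g : EnergyFun} {ρ σ : WithBot ℝ≥0} (hf : HasRate f ρ) (hg : HasRate g σ)
    (cf : ClosedReach f) (cg : ClosedReach g) : HasRate (comp f g) (ρ ⊔ σ) where
  le_add_gain h := by
    obtain ⟨t₁, t₂, z, rfl, h₁, h₂⟩ := (reach_comp_iff cf cg).1 h
    rw [gain_add, ← add_assoc]
    exact (hg.le_add_gain h₂).trans (add_le_add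
      ((hf.le_add_gain h₁).trans (add_le_add le_rfl (gain_mono le_sup_left _)))
      (gain_mono le_sup_right _))
  add_delay h s := by
    obtain ⟨t₁, t₂, z, rfl, h₁, h₂⟩ := (reach_comp_iff cf cg).1 h
    rcases le_total ρ σ with hle | hle
    · rw [sup_eq_right.2 hle, add_assoc]
      exact h₁.comp (hg.add_delay h₂ s)
    · rw [sup_eq_left.2 hle, add_right_comm]
      exact (hf.add_delay h₁ s).comp (hg.add_energy h₂ _)
  add_energy h e := by
    obtain ⟨t₁, t₂, z, rfl, h₁, h₂⟩ := (reach_comp_iff cf cg).1 h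
    exact (hf.add_energy h₁ e).comp (hg.add_energy h₂ e)

/-- With `P = -p` moved to the left, both conditions avoid truncated subtraction and hold uniformly,
also for infinite energy or time. -/
theorem IsAtomic.exists_reach_iff {f : EnergyFun} (h : IsAtomic f) :
    ∃ r B P : ℝ≥0, P ≤ B ∧ ∀ x t y : ℝ≥0∞,
      Reach f x t y ↔ (B : ℝ≥0∞) ≤ x + gain r t ∧ y + P ≤ x + gain r t := by
  obtain ⟨r, b, p, hr, hp, hb, h⟩ := h
  lift r to ℝ≥0 using hr
  obtain ⟨P, rfl⟩ : ∃ P : ℝ≥0, p = -P :=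
    ⟨(-p).toNNReal, by rw [Real.coe_toNNReal _ (by linarith), neg_neg]⟩
  obtain ⟨B, rfl⟩ : ∃ B : ℝ≥0, b = B :=
    ⟨b.toNNReal, by rw [Real.coe_toNNReal _ (by linarith)]⟩
  have hPB : P ≤ B := by simpa using hb
  refine ⟨r, B, P, hPB, fun x t y => ?_⟩
  cases t with
  | top => simp [Reach, h.map_time_top _ WithBot.coe_ne_bot, gain]
  | coe t =>
    cases x with
    | top =>
      rw [Reach, h.map_top]
      simp
    | coe x =>
      have e : ((x : ℝ≥0∞) + gain (r : WithBot ℝ≥0) (t : ℝ≥0∞)) = ((x + r * t : ℝ≥0) : ℝ≥0∞) := by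
        simp [gain]
      rw [e]
      by_cases hle : B ≤ x + r * t
      · have h₁ := h.map_of_le x t (by exact_mod_cast hle)
        have h₂ : ENNReal.ofReal ((x : ℝ) + r * t + -P) = ((x + r * t - P : ℝ≥0) : ℝ≥0∞) := by
          rw [← ENNReal.ofReal_coe_nnreal, NNReal.coe_sub (hPB.trans hle)]
          push_cast
          rfl
        rw [Reach, h₁, h₂, WithBot.coe_le_coe, ENNReal.coe_sub]
        simp only [ENNReal.coe_le_coe, hle, true_and]
        exact (ENNReal.cancel_coe.le_tsub_iff_right (ENNReal.coe_le_coe.2 (hPB.trans hle)))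
      · have h₁ := h.map_of_lt x t (by exact_mod_cast not_le.1 hle)
        rw [Reach, h₁]
        exact iff_of_false (fun h => WithBot.coe_ne_bot (le_bot_iff.1 h))
          fun h => hle (ENNReal.coe_le_coe.1 h.1)

/-- For `r = 0` the gain jumps at `t = ∞`. It jumps upwards, so the set is still the union of two
closed sets: `t = ∞`, and the inequality with the continuous gain `r * t`. -/
theorem isClosed_le_add_gain (r : ℝ≥0) {φ : ℝ≥0∞ × ℝ≥0∞ × ℝ≥0∞ → ℝ≥0∞} (hφ : Continuous φ) :
    IsClosed {p : ℝ≥0∞ × ℝ≥0∞ × ℝ≥0∞ | φ p ≤ p.1 + gain r p.2.1} := by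
  have h₁ : IsClosed {p : ℝ≥0∞ × ℝ≥0∞ × ℝ≥0∞ | p.2.1 = ∞} :=
    isClosed_eq (by fun_prop) (by fun_prop)
  have h₂ : IsClosed {p : ℝ≥0∞ × ℝ≥0∞ × ℝ≥0∞ | φ p ≤ p.1 + r * p.2.1} :=
    isClosed_le hφ (continuous_fst.add
      ((ENNReal.continuous_const_mul ENNReal.coe_ne_top).comp (by fun_prop)))
  convert h₁.union h₂ using 1
  ext ⟨x, t, y⟩
  by_cases ht : t = ∞ <;> simp [gain, ht]

theorem IsAtomic.closedReach {f : EnergyFun} (h : IsAtomic f) : ClosedReach f := by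
  obtain ⟨r, B, P, -, h⟩ := h.exists_reach_iff
  simp only [ClosedReach, h]
  exact (isClosed_le_add_gain r (by fun_prop)).inter (isClosed_le_add_gain r (by fun_prop))

theorem IsAtomic.exists_hasRate {f : EnergyFun} (h : IsAtomic f) : ∃ ρ, HasRate f ρ := by
  obtain ⟨r, B, P, -, h⟩ := h.exists_reach_iff
  refine ⟨r, ⟨fun {x t y} hf => ?_, fun {x t y} hf s => ?_, fun {x t y} hf e => ?_⟩⟩
  · exact le_self_add.trans ((h x t y).1 hf).2
  · rw [h] at hf ⊢
    rw [gain_add, ← add_assoc, add_right_comm y]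
    exact ⟨hf.1.trans le_self_add, add_le_add_left hf.2 _⟩
  · rw [h] at hf ⊢
    rw [add_right_comm x, add_right_comm y]
    exact ⟨hf.1.trans le_self_add, add_le_add_left hf.2 _⟩

theorem IsRTEF.closedReach {f : EnergyFun} (h : IsRTEF f) : ClosedReach f := by
  induction h with
  | atomic f hf => exact hf.closedReach
  | bot => exact closedReach_bot
  | one => exact closedReach_one
  | comp f g _ _ hf hg => exact closedReach_comp hf hg
  | sup f g _ _ hf hg => exact closedReach_sup hf hg

/-! ### The star-continuous Kleene algebra of real-time energy functions -/

noncomputable scoped instance : SemilatticeSup RTEF :=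
  Subtype.semilatticeSup fun {f g} hf hg => IsRTEF.sup f g hf hg

noncomputable scoped instance : OrderBot RTEF := Subtype.orderBot IsRTEF.bot

noncomputable scoped instance : Zero RTEF := ⟨⊥⟩

noncomputable scoped instance : Add RTEF := ⟨(· ⊔ ·)⟩

noncomputable scoped instance : IdemSemiring RTEF where
  mul f g := ⟨comp f.1 g.1, IsRTEF.comp _ _ f.2 g.2⟩
  one := ⟨one, IsRTEF.one⟩
  nsmul := nsmulRec
  add_assoc := sup_assoc
  add_comm := sup_comm
  zero_add _ := bot_sup_eq _
  add_zero _ := sup_bot_eq _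
  mul_assoc f g h := Subtype.ext (comp_assoc f.2.closedReach g.2.closedReach h.1)
  one_mul f := Subtype.ext (one_comp f.1)
  mul_one f := Subtype.ext (comp_one f.1)
  zero_mul f := Subtype.ext (bot_comp f.1)
  mul_zero f := Subtype.ext (comp_bot f.1)
  left_distrib f g h := Subtype.ext (comp_sup f.1 g.1 h.1)
  right_distrib f g h := Subtype.ext (sup_comp f.1 g.1 h.1)
  sup := (· ⊔ ·)
  le_sup_left _ _ := le_sup_left
  le_sup_right _ _ := le_sup_right
  sup_le _ _ _ := sup_le
  bot_le _ := bot_le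
  add_eq_sup _ _ := rfl

theorem RTEF.closedReach (f : RTEF) : ClosedReach f.1 := IsRTEF.closedReach f.2

theorem RTEF.coe_pow (f : RTEF) (n : ℕ) : (f ^ n).1 = iter f.1 n := by
  induction n with
  | zero => rw [pow_zero]; rfl
  | succ n ih =>
    rw [pow_succ, iter, ← ih]
    rfl

/-- Functions of a definite rate, which form a submonoid. -/
def rated : Submonoid RTEF where
  carrier := {f | ∃ ρ, HasRate f.1 ρ}
  one_mem' := ⟨⊥, hasRate_one⟩
  mul_mem' {f g} := fun ⟨_, hf⟩ ⟨_, hg⟩ => ⟨_, hf.comp hg f.closedReach g.closedReach⟩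

theorem mem_subsemiringClosure_rated {f : EnergyFun} (hf : IsRTEF f) :
    -- The induction runs over bare functions, so the claim is made for every bundled `F` lying over
    -- `f`.
    ∀ F : RTEF, F.1 = f → F ∈ rated.subsemiringClosure := by
  induction hf with
  | atomic f hf =>
    rintro F rfl
    rw [← SetLike.mem_coe, Submonoid.subsemiringClosure_coe]
    exact AddSubmonoid.subset_closure (show F ∈ rated from hf.exists_hasRate)
  | bot =>
    intro F hF
    rw [show F = 0 from Subtype.ext hF]
    exact zero_mem _
  | one =>
    intro F hF
    rw [show F = 1 from Subtype.ext hF]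
    exact one_mem _
  | comp f g hf hg ihf ihg =>
    intro F hF
    obtain ⟨A, rfl⟩ : ∃ A : RTEF, A.1 = f := ⟨⟨f, hf⟩, rfl⟩
    obtain ⟨B, rfl⟩ : ∃ B : RTEF, B.1 = g := ⟨⟨g, hg⟩, rfl⟩
    rw [show F = A * B from Subtype.ext hF]
    exact mul_mem (ihf _ rfl) (ihg _ rfl)
  | sup f g hf hg ihf ihg =>
    intro F hF
    obtain ⟨A, rfl⟩ : ∃ A : RTEF, A.1 = f := ⟨⟨f, hf⟩, rfl⟩
    obtain ⟨B, rfl⟩ : ∃ B : RTEF, B.1 = g := ⟨⟨g, hg⟩, rfl⟩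
    rw [show F = A + B from Subtype.ext hF]
    exact add_mem (ihf _ rfl) (ihg _ rfl)

theorem mem_closure_rated (f : RTEF) : f ∈ AddSubmonoid.closure (rated : Set RTEF) := by
  rw [← SetLike.mem_coe, ← Submonoid.subsemiringClosure_coe]
  exact mem_subsemiringClosure_rated f.2 f rfl

theorem exists_finset_sup_eq (f : RTEF) :
    ∃ s : Finset RTEF, (∀ a ∈ s, a ∈ rated) ∧ s.sup id = f := by
  classical
  induction mem_closure_rated f using AddSubmonoid.closure_induction with
  | mem a ha => exact ⟨{a}, by simpa using ha, by simp⟩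
  | zero => exact ⟨∅, by simp, rfl⟩
  | add a b _ _ ha hb =>
    obtain ⟨s, hs, rfl⟩ := ha
    obtain ⟨s', hs', rfl⟩ := hb
    refine ⟨s ∪ s', fun a ha => ?_, Finset.sup_union⟩
    exact (Finset.mem_union.1 ha).elim (hs a) (hs' a)

/-- The delay `t₂` spent in `b` is given to `a` instead, which then gains at least as much. -/
theorem mul_le_left_of_hasRate {a b : RTEF} {ρ σ : WithBot ℝ≥0} (ha : HasRate a.1 ρ)
    (hb : HasRate b.1 σ) (h : σ ≤ ρ) : a * b ≤ a := by
  refine le_of_reach fun x t y hr => ?_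
  obtain ⟨t₁, t₂, z, rfl, h₁, h₂⟩ := (reach_comp_iff a.closedReach b.closedReach).1 hr
  exact (ha.add_delay h₁ t₂).mono le_rfl le_rfl
    ((hb.le_add_gain h₂).trans (add_le_add le_rfl (gain_mono h t₂)))

/-- Since `a` absorbs `a` and `x` on its right, and `H` absorbs `x`, the element `H + H * a` absorbs
further factors `1 + (a + x)`. It equals `H * (1 + a)`, hence one extra power. -/
theorem one_add_pow_add_le {S : Type*} [IdemSemiring S] {x a : S} {N : ℕ}
    (hN : ∀ n, (1 + x) ^ n ≤ (1 + x) ^ N) (haa : a * a ≤ a) (hax : a * x ≤ a) (n : ℕ) :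
    (1 + (a + x)) ^ n ≤ (1 + (a + x)) ^ (N + 1) := by
  set H := (1 + x) ^ N with hH
  have hHx : H * x ≤ H := by
    refine le_trans ?_ (hN (N + 1))
    rw [pow_succ]
    exact mul_le_mul_right (by simp) _
  have hT : ∀ n, (1 + (a + x)) ^ n ≤ H + H * a := by
    intro n
    induction n with
    | zero =>
      have h₁ := hN 0
      rw [pow_zero] at h₁ ⊢
      exact h₁.trans (by simp)
    | succ n ih =>
      rw [pow_succ]
      refine (mul_le_mul_left ih _).trans ?_
      have h₁ : H * a * a ≤ H * a := by rw [mul_assoc]; exact mul_le_mul_right haa _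
      have h₂ : H * a * x ≤ H * a := by rw [mul_assoc]; exact mul_le_mul_right hax _
      simp only [mul_add, add_mul, mul_one, add_le_iff]
      have h₃ : H ≤ H + H * a := by simp
      have h₄ : H * a ≤ H + H * a := by simp
      exact ⟨⟨h₃, h₄⟩, ⟨h₄, h₁.trans h₄⟩, hHx.trans h₃, h₂.trans h₄⟩
  refine (hT n).trans ?_
  have hle : H ≤ (1 + (a + x)) ^ N := pow_le_pow_left' (by gcongr; simp) N
  rw [pow_succ]
  calc H + H * a = H * (1 + a) := by rw [mul_add, mul_one]
    _ ≤ _ := mul_le_mul' hle (by gcongr; simp)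

/-- The powers of `1 ∨ f` stabilise: every block of a long run can be absorbed into the last
block of maximal rate. -/
theorem exists_one_add_pow_le (f : RTEF) : ∃ N, ∀ n, (1 + f) ^ n ≤ (1 + f) ^ N := by
  classical
  obtain ⟨s, hs, rfl⟩ := exists_finset_sup_eq f
  -- The induction by maximal value needs a rate for every element; outside `rated` the value `⊥` is
  -- a dummy.
  have hρ : ∀ a : RTEF, ∃ ρ, a ∈ rated → HasRate a.1 ρ := fun a => by
    by_cases h : a ∈ rated
    · exact h.imp fun ρ hρ _ => hρ
    · exact ⟨⊥, fun h' => absurd h' h⟩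
  choose ρ hρ using hρ
  induction s using Finset.induction_on_max_value ρ with
  | empty => exact ⟨0, fun n => by simp [show (⊥ : RTEF) = 0 from rfl]⟩
  | insert a s _ hmax ih =>
    obtain ⟨N, hN⟩ := ih fun b hb => hs b (Finset.mem_insert_of_mem hb)
    have ha := hρ a (hs a (Finset.mem_insert_self a s))
    rw [Finset.sup_insert]
    refine ⟨N + 1, one_add_pow_add_le hN (mul_le_left_of_hasRate ha ha le_rfl) ?_⟩
    refine Finset.sup_induction (p := fun b => a * b ≤ a) ?_ ?_ fun b hb => ?_
    · exact (mul_zero a).trans_le bot_le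
    · intro b hb c hc
      rw [← add_eq_sup, mul_add]
      exact add_le hb hc
    · exact mul_le_left_of_hasRate ha (hρ b (hs b (Finset.mem_insert_of_mem hb))) (hmax b hb)

/-- `(1 + x) ^ N` expands to a finite join of powers of `x`. The induction moves one factor `1 + x`
into `y`, which is therefore generalised. -/
theorem map_mul_one_add_pow_mul_le {S V : Type*} [IdemSemiring S] [SemilatticeSup V] (φ : S → V)
    (hφ : ∀ a b, φ (a + b) = φ a ⊔ φ b) {x y z : S} {w : V} (h : ∀ n, φ (y * x ^ n * z) ≤ w)
    (N : ℕ) : φ (y * (1 + x) ^ N * z) ≤ w := by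
  induction N generalizing y with
  | zero => simpa using h 0
  | succ N ih =>
    rw [pow_succ', ← mul_assoc, mul_add, mul_one]
    refine ih fun n => ?_
    rw [add_mul, add_mul, hφ]
    refine sup_le (h n) ?_
    rw [mul_assoc y, ← pow_succ']
    exact h (n + 1)

-- The star as a stable power of `1 + f`

noncomputable scoped instance : KStar RTEF := ⟨fun f => (1 + f) ^ (exists_one_add_pow_le f).choose⟩

theorem pow_le_kstar (f : RTEF) (n : ℕ) : f ^ n ≤ f∗ :=
  (pow_le_pow_left' (by simp) n).trans ((exists_one_add_pow_le f).choose_spec n)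

/-- Maps that preserve binary joins preserve the suprema that define the star. -/
theorem map_mul_kstar_mul_le {V : Type*} [SemilatticeSup V] (φ : RTEF → V)
    (hφ : ∀ a b, φ (a + b) = φ a ⊔ φ b) {x y z : RTEF} {w : V}
    (h : ∀ n, φ (y * x ^ n * z) ≤ w) : φ (y * x∗ * z) ≤ w :=
  map_mul_one_add_pow_mul_le φ hφ h _

theorem isLUB_map_mul_kstar_mul {V : Type*} [SemilatticeSup V] (φ : RTEF → V)
    (hφ : ∀ a b, φ (a + b) = φ a ⊔ φ b) (x y z : RTEF) :
    IsLUB (Set.range fun n : ℕ => φ (y * x ^ n * z)) (φ (y * x∗ * z)) := by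
  refine ⟨?_, fun w hw => map_mul_kstar_mul_le φ hφ fun n => hw ⟨n, rfl⟩⟩
  rintro _ ⟨n, rfl⟩
  have hle : y * x ^ n * z ≤ y * x∗ * z :=
    mul_le_mul_left (mul_le_mul_right (pow_le_kstar x n) y) z
  rw [← hle.add_eq_right, hφ]
  exact le_sup_left

noncomputable scoped instance : KleeneAlgebra RTEF where
  one_le_kstar a := pow_zero a ▸ pow_le_kstar a 0
  mul_kstar_le_kstar a := by
    have := map_mul_kstar_mul_le (id : RTEF → RTEF) (fun _ _ => rfl) (x := a) (y := a) (z := 1)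
      (w := a∗) fun n => by
        rw [mul_one, ← pow_succ']
        exact pow_le_kstar a (n + 1)
    simpa using this
  kstar_mul_le_kstar a := by
    have := map_mul_kstar_mul_le (id : RTEF → RTEF) (fun _ _ => rfl) (x := a) (y := 1) (z := a)
      (w := a∗) fun n => by
        rw [one_mul, ← pow_succ]
        exact pow_le_kstar a (n + 1)
    simpa using this
  mul_kstar_le_self a b h := by
    have := map_mul_kstar_mul_le (id : RTEF → RTEF) (fun _ _ => rfl) (x := a) (y := b) (z := 1)
      (w := b) fun n => by
        rw [mul_one]
        induction n with
        | zero => simp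
        | succ n ih =>
          rw [pow_succ, ← mul_assoc]
          exact (mul_le_mul_left ih a).trans h
    simpa using this
  kstar_mul_le_self a b h := by
    have := map_mul_kstar_mul_le (id : RTEF → RTEF) (fun _ _ => rfl) (x := a) (y := 1) (z := b)
      (w := b) fun n => by
        rw [one_mul]
        induction n with
        | zero => simp
        | succ n ih =>
          rw [pow_succ', mul_assoc]
          exact (mul_le_mul_right ih a).trans h
    simpa using this

noncomputable scoped instance starContinuousKleeneAlgebra : StarContinuousKleeneAlgebra RTEF where
  isLUB_kstar x := by
    simpa using isLUB_map_mul_kstar_mul (id : RTEF → RTEF) (fun _ _ => rfl) x 1 1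
  isLUB_mul_kstar x y := by
    simpa using isLUB_map_mul_kstar_mul (id : RTEF → RTEF) (fun _ _ => rfl) x y 1
  isLUB_kstar_mul x y := by
    simpa using isLUB_map_mul_kstar_mul (id : RTEF → RTEF) (fun _ _ => rfl) x 1 y

theorem RTEF.coe_kstar (f : RTEF) : (f∗).1 = star f.1 := by
  refine TimedFun.ext fun x t => ?_
  -- Evaluation at a point preserves binary joins, so the star is also the pointwise supremum.
  have := isLUB_map_mul_kstar_mul (fun g : RTEF => g.1.1 (x, t)) (fun _ _ => rfl) f 1 1
  simp only [one_mul, mul_one, RTEF.coe_pow] at this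
  exact this.unique isLUB_iSup

/-! ### Infinite products -/

section prefixVal

variable {f g : ℕ → EnergyFun} {τ : ℕ → ℝ≥0∞} {x : Level} {t : ℝ≥0∞}

theorem prefixVal_succ' (f : ℕ → EnergyFun) (τ : ℕ → ℝ≥0∞) (x : Level) (n : ℕ) :
    prefixVal f τ x (n + 1) =
      prefixVal (fun i => f (i + 1)) (fun i => τ (i + 1)) ((f 0).1 (x, τ 0)) n := by
  induction n with
  | zero => rfl
  | succ n ih => rw [prefixVal, ih]; rfl

theorem prefixVal_eq_bot_of_le {m n : ℕ} (h : m ≤ n) (hm : prefixVal f τ x m = ⊥) :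
    prefixVal f τ x n = ⊥ := by
  induction n, h using Nat.le_induction with
  | base => exact hm
  | succ n _ ih => rw [prefixVal, ih, (f n).2.2]

/-- The comparison is required only at the arguments met by the run of `f`, so `g` may be chosen
depending on that run. -/
theorem prefixVal_le_prefixVal
    (h : ∀ n, (f n).1 (prefixVal f τ x n, τ n) ≤ (g n).1 (prefixVal f τ x n, τ n)) (n : ℕ) :
    prefixVal f τ x n ≤ prefixVal g τ x n := by
  induction n with
  | zero => exact le_rfl
  | succ n ih => exact (h n).trans ((g n).apply_mono ih (τ n))

theorem infProd_of_tsum_le (ht : ∑' n, τ n ≤ t) (h : ∀ n, prefixVal f τ x (n + 1) ≠ ⊥) :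
    (infProd f).1 (x, t) :=
  (infProd f).2.1 (Prod.mk_le_mk.2 ⟨le_refl x, ht⟩) ⟨τ, rfl, h⟩

theorem infProd_mono (h : ∀ n, f n ≤ g n) : infProd f ≤ infProd g := by
  rintro ⟨x, t⟩ ⟨τ, hτ, hne⟩
  exact ⟨τ, hτ, fun n => ne_bot_of_le_ne_bot (hne n)
    (prefixVal_le_prefixVal (fun n => h n _) (n + 1))⟩

/-- An infinite product whose factors select, at every argument, one of several alternatives is
bounded by the products of the alternatives. -/
theorem infProd_le_of_forall_exists {ι : Type*} {g : ℕ → ι → EnergyFun} {w : BoolFun}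
    (hg : ∀ n p, ∃ i, (f n).1 p ≤ (g n i).1 p)
    (hw : ∀ k : ℕ → ι, infProd (fun n => g n (k n)) ≤ w) : infProd f ≤ w := by
  rintro ⟨x, t⟩ ⟨τ, hτ, hne⟩
  choose k hk using fun n => hg n (prefixVal f τ x n, τ n)
  exact hw k (x, t) ⟨τ, hτ, fun n => ne_bot_of_le_ne_bot (hne n)
    (prefixVal_le_prefixVal hk (n + 1))⟩

theorem infProd_eq_comp (f : ℕ → EnergyFun) :
    infProd f = comp (f 0) (infProd fun n => f (n + 1)) := by
  refine le_antisymm ?_ ?_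
  · rintro ⟨x, t⟩ ⟨τ, hτ, hne⟩
    rw [tsum_eq_zero_add' ENNReal.summable] at hτ
    obtain rfl : _ = t := hτ
    refine le_comp_apply (f 0) (infProd fun n => f (n + 1)) x _ _ ⟨_, rfl, fun n => ?_⟩
    rw [← prefixVal_succ']
    exact hne (n + 1)
  · rintro ⟨x, t⟩
    refine comp_apply_le ?_
    rintro t₁ t₂ rfl ⟨τ, hτ, hne⟩
    obtain rfl : _ = t₂ := hτ
    refine ⟨fun n => n.casesOn t₁ τ, tsum_eq_zero_add' ENNReal.summable, fun n => ?_⟩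
    rw [prefixVal_succ']
    -- The hypothesis on the tail concerns prefixes of length at least one; since `⊥` persists, it
    -- also excludes `⊥` at length `n`.
    intro h
    exact hne n (prefixVal_eq_bot_of_le n.le_succ h)

end prefixVal

/-! ### Regrouping the factors of an infinite product -/

section block

/-- The product of the `l` factors of `x` from index `a` on. -/
noncomputable def block (x : ℕ → RTEF) (a l : ℕ) : RTEF :=
  (List.ofFn fun i : Fin l => x (a + (i : ℕ))).prod

theorem block_zero (x : ℕ → RTEF) (a : ℕ) : block x a 0 = 1 := by
  simp [block]

theorem block_succ (x : ℕ → RTEF) (a l : ℕ) : block x a (l + 1) = block x a l * x (a + l) := by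
  rw [block, List.ofFn_succ', List.concat_eq_append, List.prod_append, List.prod_singleton]
  rfl

theorem coe_block_zero (x : ℕ → RTEF) (a : ℕ) (v : Level) (t : ℝ≥0∞) :
    (block x a 0).1.1 (v, t) = v := by
  rw [block_zero]
  rfl

theorem coe_block_succ (x : ℕ → RTEF) (a l : ℕ) :
    (block x a (l + 1)).1 = comp (block x a l).1 (x (a + l)).1 := by
  rw [block_succ]
  rfl

theorem prefixVal_add_le_block (x : ℕ → RTEF) (τ : ℕ → ℝ≥0∞) (u : Level) (a l : ℕ) :
    prefixVal (fun n => (x n).1) τ u (a + l) ≤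
      (block x a l).1.1 (prefixVal (fun n => (x n).1) τ u a,
        ∑ i ∈ Finset.range l, τ (a + i)) := by
  induction l with
  | zero => rw [coe_block_zero]; exact le_rfl
  | succ l ih =>
    rw [Finset.sum_range_succ, coe_block_succ]
    exact ((x (a + l)).1.apply_mono ih _).trans (le_comp_apply _ _ _ _ _)

/-- Attainment at each composition provides the delays. The conclusion allows any `τ'` agreeing on
the block and any start at or above `v`, so that the delays of successive blocks can be glued. -/
theorem exists_delays_of_block (x : ℕ → RTEF) (a l : ℕ) (v : Level) (s : ℝ≥0∞) :
    ∃ τ : ℕ → ℝ≥0∞, ∑ i ∈ Finset.range l, τ (a + i) ≤ s ∧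
      ∀ (τ' : ℕ → ℝ≥0∞) (u : Level), (∀ i < l, τ' (a + i) = τ (a + i)) →
        v ≤ prefixVal (fun n => (x n).1) τ' u a →
        (block x a l).1.1 (v, s) ≤ prefixVal (fun n => (x n).1) τ' u (a + l) := by
  induction l generalizing s with
  | zero => exact ⟨0, by simp, fun τ' u _ h => by rwa [coe_block_zero]⟩
  | succ l ih =>
    obtain ⟨t₁, t₂, rfl, e⟩ :=
      exists_comp_apply_eq (block x a l).closedReach (x (a + l)).closedReach v s
    obtain ⟨τ, hτ, h⟩ := ih t₁
    have hlt : ∀ i < l, Function.update τ (a + l) t₂ (a + i) = τ (a + i) := fun i hi =>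
      Function.update_of_ne (by omega) _ _
    refine ⟨Function.update τ (a + l) t₂, ?_, fun τ' u hτ' hv => ?_⟩
    · rw [Finset.sum_range_succ, Function.update_self,
        Finset.sum_congr rfl fun i hi => hlt i (Finset.mem_range.1 hi)]
      gcongr
    · rw [coe_block_succ, e]
      have hl := hτ' l l.lt_succ_self
      rw [Function.update_self] at hl
      rw [← add_assoc, prefixVal, hl]
      exact (x (a + l)).1.apply_mono
        (h τ' u (fun i hi => (hτ' i (hi.trans l.lt_succ_self)).trans (hlt i hi)) hv) _

variable {n : ℕ → ℕ}

theorem sum_range_sum_block (hn : Monotone n) (h0 : n 0 = 0) (τ : ℕ → ℝ≥0∞) (K : ℕ) :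
    ∑ k ∈ Finset.range K, ∑ i ∈ Finset.range (n (k + 1) - n k), τ (n k + i) =
      ∑ m ∈ Finset.range (n K), τ m := by
  induction K with
  | zero => simp [h0]
  | succ K ih =>
    rw [Finset.sum_range_succ, ih, ← Finset.sum_range_add,
      Nat.add_sub_cancel' (hn K.le_succ)]

theorem exists_glue {Y : Type*} (hn : Monotone n) (hu : ∀ m, ∃ k, m ≤ n k) (σ : ℕ → ℕ → Y) :
    ∃ τ : ℕ → Y, ∀ k, ∀ i < n (k + 1) - n k, τ (n k + i) = σ k (n k + i) := by
  have hex : ∀ m, ∃ k, m < n (k + 1) := fun m => by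
    obtain ⟨k, hk⟩ := hu (m + 1)
    exact ⟨k, (Nat.lt_of_succ_le hk).trans_le (hn k.le_succ)⟩
  -- Index `m` belongs to the first block that ends beyond `m`; empty blocks are thereby skipped.
  refine ⟨fun m => σ (Nat.find (hex m)) m, fun k i hi => ?_⟩
  have : Nat.find (hex (n k + i)) = k := by
    refine (Nat.find_eq_iff _).2 ⟨by omega, fun j hj => ?_⟩
    exact not_lt.2 ((hn (Nat.succ_le_of_lt hj)).trans (Nat.le_add_right _ _))
  simp only [this]

theorem infProd_le_infProd_block (hn : Monotone n) (h0 : n 0 = 0) (x : ℕ → RTEF) :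
    infProd (fun m => (x m).1) ≤ infProd fun k => (block x (n k) (n (k + 1) - n k)).1 := by
  rintro ⟨u, t⟩ ⟨τ, hτ, hne⟩
  set σ : ℕ → ℝ≥0∞ := fun k => ∑ i ∈ Finset.range (n (k + 1) - n k), τ (n k + i) with hσ
  have hle : ∀ k, prefixVal (fun m => (x m).1) τ u (n k) ≤
      prefixVal (fun k => (block x (n k) (n (k + 1) - n k)).1) σ u k := by
    intro k
    induction k with
    | zero => rw [h0]; exact le_rfl
    | succ k ih =>
      have := prefixVal_add_le_block x τ u (n k) (n (k + 1) - n k)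
      rw [Nat.add_sub_cancel' (hn k.le_succ)] at this
      exact this.trans (TimedFun.apply_mono _ ih _)
  refine infProd_of_tsum_le (τ := σ) ?_ fun k => ne_bot_of_le_ne_bot (fun h => ?_) (hle (k + 1))
  · refine ENNReal.tsum_le_of_sum_range_le fun K => ?_
    rw [hσ, sum_range_sum_block hn h0]
    exact (ENNReal.sum_le_tsum _).trans hτ.le
  · exact hne _ (prefixVal_eq_bot_of_le (Nat.le_succ _) h)

theorem infProd_block_le_infProd (hn : Monotone n) (h0 : n 0 = 0) (hu : ∀ m, ∃ k, m ≤ n k)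
    (x : ℕ → RTEF) :
    infProd (fun k => (block x (n k) (n (k + 1) - n k)).1) ≤ infProd fun m => (x m).1 := by
  rintro ⟨u, t⟩ ⟨σ, hσ, hne⟩
  choose τ' hτ' hle' using fun k => exists_delays_of_block x (n k) (n (k + 1) - n k)
    (prefixVal (fun k => (block x (n k) (n (k + 1) - n k)).1) σ u k) (σ k)
  obtain ⟨τ, hτ⟩ := exists_glue hn hu τ'
  have hle : ∀ k, prefixVal (fun k => (block x (n k) (n (k + 1) - n k)).1) σ u k ≤
      prefixVal (fun m => (x m).1) τ u (n k) := by
    intro k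
    induction k with
    | zero => rw [h0]; exact le_rfl
    | succ k ih =>
      have := hle' k τ u (hτ k) ih
      rwa [Nat.add_sub_cancel' (hn k.le_succ)] at this
  refine infProd_of_tsum_le (τ := τ) ?_ fun m h => ?_
  · refine ENNReal.tsum_le_of_sum_range_le fun M => ?_
    obtain ⟨K, hK⟩ := hu M
    calc ∑ m ∈ Finset.range M, τ m ≤ ∑ m ∈ Finset.range (n K), τ m :=
          Finset.sum_le_sum_of_subset (Finset.range_mono hK)
      _ = ∑ k ∈ Finset.range K, ∑ i ∈ Finset.range (n (k + 1) - n k), τ (n k + i) :=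
          (sum_range_sum_block hn h0 τ K).symm
      _ ≤ ∑ k ∈ Finset.range K, σ k := by
          refine Finset.sum_le_sum fun k _ => ?_
          rw [Finset.sum_congr rfl fun i hi => hτ k i (Finset.mem_range.1 hi)]
          exact hτ' k
      _ ≤ ∑' k, σ k := ENNReal.sum_le_tsum _
      _ = t := hσ
  · obtain ⟨k, hk⟩ := hu (m + 1)
    have hbot := prefixVal_eq_bot_of_le (hk.trans (hn k.le_succ)) h
    exact hne k (le_bot_iff.1 (hbot ▸ hle (k + 1)))

end block

/-! ### The omega-algebra -/

/-- In a linear order, being above a fixed value turns joins into disjunctions. So this predicate is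
a join-preserving map to `Prop`, to which the principle for the star applies. -/
theorem exists_le_pow_mul (x y : RTEF) (p : Level × ℝ≥0∞) :
    ∃ n : ℕ, (x∗ * y).1.1 p ≤ (x ^ n * y).1.1 p := by
  have := map_mul_kstar_mul_le (fun g : RTEF => (x∗ * y).1.1 p ≤ g.1.1 p)
    (fun _ _ => propext le_sup_iff) (x := x) (y := 1) (z := y)
    (w := ∃ n : ℕ, (x∗ * y).1.1 p ≤ (x ^ n * y).1.1 p)
    fun n h => ⟨n, by rwa [one_mul] at h⟩
  rw [one_mul] at this
  exact this le_rfl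

/-- The action of real-time energy functions by composition on the functions generated by infinite
products, provided that scalars may be real-time energy functions. -/
noncomputable abbrev omegaAlgebra {G : Set EnergyFun} (hG : ∀ f, IsRTEF f → f ∈ G) :
    StarContinuousKleeneOmegaAlgebra RTEF (Span G) where
  smul f v := ⟨comp f.1 v.1, InSpan.smul _ _ (hG _ f.2) v.2⟩
  sup_smul f g v := Subtype.ext (sup_comp f.1 g.1 v.1)
  smul_sup f v w := Subtype.ext (comp_sup f.1 v.1 w.1)
  bot_smul v := Subtype.ext (bot_comp v.1)
  mul_smul f g v := Subtype.ext (comp_assoc f.closedReach g.closedReach v.1)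
  smul_bot f := Subtype.ext (comp_bot f.1)
  one_smul v := Subtype.ext (one_comp v.1)
  isLUB_mul_kstar_smul x y v := by
    have := isLUB_map_mul_kstar_mul
      (fun f : RTEF => (⟨comp f.1 v.1, InSpan.smul _ _ (hG _ f.2) v.2⟩ : Span G))
      (fun f g => Subtype.ext (sup_comp f.1 g.1 v.1)) y x 1
    simp only [mul_one] at this
    exact this
  infProd f := ⟨infProd fun n => (f n).1, InSpan.infProd _ fun n => (f n).2⟩
  ax1 x := Subtype.ext (infProd_eq_comp fun n => (x n).1)
  ax2 x _ h0 hn hu := Subtype.ext (le_antisymm (infProd_le_infProd_block hn h0 x)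
    (infProd_block_le_infProd hn h0 hu x))
  ax3 x y z := by
    refine ⟨?_, fun w hw => ?_⟩
    · rintro _ ⟨x', hx', rfl⟩
      refine infProd_mono fun n => ?_
      rcases hx' n with h | h
      · exact mul_le_mul_right (h.trans_le le_sup_left) (x n)
      · exact mul_le_mul_right (h.trans_le le_sup_right) (x n)
    -- The alternatives are indexed by the subtype of `{y, z}`, so that a choice function along a
    -- run is exactly an admissible sequence `x'`.
    · refine infProd_le_of_forall_exists
        (g := fun n (a : {a : RTEF // a = y ∨ a = z}) => (x n * a.1).1) (fun n p => ?_) fun k =>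
        hw ⟨fun n => (k n).1, fun n => (k n).2, rfl⟩
      have h : (x n * (y ⊔ z)).1.1 p ≤ (x n * y).1.1 p ⊔ (x n * z).1.1 p := by
        rw [← add_eq_sup, mul_add]
        exact le_rfl
      rcases le_sup_iff.1 h with h | h
      · exact ⟨⟨y, Or.inl rfl⟩, h⟩
      · exact ⟨⟨z, Or.inr rfl⟩, h⟩
  ax4 x y := by
    refine ⟨?_, fun w hw => ?_⟩
    · rintro _ ⟨k, rfl⟩
      exact infProd_mono fun n => mul_le_mul_left (pow_le_kstar x (k n)) (y n)
    · exact infProd_le_of_forall_exists (g := fun n k => (x ^ k * y n).1)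
        (fun n p => exists_le_pow_mul x (y n) p) fun k => hw ⟨k, rfl⟩

end RealTimeEnergy

/-! ### The main theorem -/

theorem mainTheorem1 :
    ∃ K : StarContinuousKleeneAlgebra RealTimeEnergy.RTEF,
      ((⊥ : RealTimeEnergy.RTEF).1 = ⊥ ∧
        (1 : RealTimeEnergy.RTEF).1 = RealTimeEnergy.one ∧
        (∀ f g : RealTimeEnergy.RTEF, (f ⊔ g).1 = f.1 ⊔ g.1) ∧
        (∀ f g : RealTimeEnergy.RTEF, (f * g).1 = RealTimeEnergy.comp f.1 g.1) ∧
        (∀ f : RealTimeEnergy.RTEF, (f∗).1 = RealTimeEnergy.star f.1)) ∧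
      ∀ G : Set RealTimeEnergy.EnergyFun,
        (G = Set.univ ∨ G = {f | RealTimeEnergy.IsRTEF f}) →
        ∃ W : StarContinuousKleeneOmegaAlgebra RealTimeEnergy.RTEF (RealTimeEnergy.Span G),
          (∀ (f : RealTimeEnergy.RTEF) (v : RealTimeEnergy.Span G),
            (f • v).1 = RealTimeEnergy.comp f.1 v.1) ∧
          (∀ f : ℕ → RealTimeEnergy.RTEF,
            (W.infProd f).1 = RealTimeEnergy.infProd fun n => (f n).1) := by
  refine ⟨RealTimeEnergy.starContinuousKleeneAlgebra, ⟨rfl, rfl, fun _ _ => rfl, fun _ _ => rfl,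
    RealTimeEnergy.RTEF.coe_kstar⟩, ?_⟩
  rintro G hG
  have hG' : ∀ f, RealTimeEnergy.IsRTEF f → f ∈ G := by
    rcases hG with rfl | rfl
    · exact fun f _ => Set.mem_univ f
    · exact fun f hf => hf
  exact ⟨RealTimeEnergy.omegaAlgebra hG', fun _ _ => rfl, fun _ => rfl⟩
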